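/- Let $q,r\ge 1$ be integers, put $b=qr$, and assume $q<b$ and $b>2$. Let $\mu=\mu_{q,b}$ be the Borel probability measure on $\mathbb R$ with $\mu(E)=\sum_{i=0}^{q-1}\frac1q\,\mu(f_i^{-1}(E))$ for all Borel sets $E$, where $f_i(x)=b^{-1}(x+i)$. A countable set $\Lambda\subset\mathbb R$ is called a spectrum of $L^2(\mu)$ if the exponentials $x\mapsto e^{2\pi i\lambda x}$, $\lambda\in\Lambda$, form an orthonormal basis of $L^2(\mu)$. Let $\Sigma_q^*$ be the set of finite words (including the empty word $\vartheta$) over $\{0,1,\dots,q-1\}$, and let $\Gamma_q$ be the set of infinite words of the form $\sigma0^\infty$ with $\sigma\in\Sigma_q^*$. For an infinite word $\omega$ let $\omega|_k$ denote its initial segment of length $k$. A map $\tau$ on $\Sigma_q^*$ is regular on $\omega\in\Gamma_q$ if $\tau(\omega|_k)=0$ for all sufficiently large $k$; in this case put $\Pi_b^\tau(\omega)=\sum_{k\ge1}\tau(\omega|_k)b^{k-1}$. A map $\tau:\Sigma_q^*\to\{-1,0,\dots,b-2\}$ is called a maximal mapping if (i) $\tau(\vartheta)=\tau(0^n)=0$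 for all $n\ge1$; (ii) $\tau(\sigma_1\cdots\sigma_k)\equiv\sigma_k\pmod q$ for all $k\ge1$ and all words $\sigma_1\cdots\sigma_k$; (iii) for every $\sigma\in\Sigma_q^*$ there is $\sigma'\in\Sigma_q^*$ such that $\tau$ is regular on $\sigma\sigma'0^\infty$. For such $\tau$ let $\Lambda(\tau)=\{\Pi_b^\tau(\omega):\omega\in\Gamma_q,\ \tau\text{ regular on }\omega\}$. A maximal mapping $\tau$ is called a spectral mapping if $r\Lambda(\tau)$ is a spectrum of $L^2(\mu_{q,b})$. **Theorem.** Let $\tau$ be a maximal mapping and let $I=\sigma_1\cdots\sigma_k$, $k\ge1$, be a finite word with $\sigma_k\ne0$. Define $\tau'(I0^\ell)=0$ for all $\ell\ge1$ and $\tau'(\sigma)=\tau(\sigma)$ for every other word $\sigma\in\Sigma_q^*$. Then $\tau'$ is a maximal mapping, and $\tau$ is a spectral mapping if and only if $\tau'$ is a spectral mapping. -/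

import Mathlib

open scoped BigOperators ENNReal
open MeasureTheory Filter

namespace CantorSpectra

/-! ### The self-similar measure -/

/-- The contraction `f_i(x) = (x + i) / b`. -/
noncomputable def contraction (b i : ℕ) (x : ℝ) : ℝ := (x + i) / b

/-- The uniform probability measure on the digits `0, …, q - 1`. -/
noncomputable def digitLaw (q : ℕ) [NeZero q] : Measure (Fin q) :=
  (PMF.uniformOfFintype (Fin q)).toMeasure

instance digitLaw_isProbabilityMeasure (q : ℕ) [NeZero q] :
    IsProbabilityMeasure (digitLaw q) := by
  unfold digitLaw; infer_instance

/-- The point `∑_{k ≥ 0} d_k b^{-(k+1)}` coded by the digit sequence `d`. -/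
noncomputable def digitSum (q b : ℕ) (d : ℕ → Fin q) : ℝ :=
  ∑' k : ℕ, ((d k : ℕ) : ℝ) / (b : ℝ) ^ (k + 1)

/-- The equal-weight self-similar measure of the maps `f_i(x) = (x + i) / b`, `0 ≤ i < q`:
the law of `∑_{k ≥ 1} d_k b^{-k}` with independent, uniformly distributed digits `d_k`. -/
noncomputable def cantorMeasure (q b : ℕ) [NeZero q] : Measure ℝ :=
  (Measure.infinitePi (fun _ : ℕ => digitLaw q)).map (digitSum q b)

theorem digitLaw_apply (q : ℕ) [NeZero q] (s : Set (Fin q)) :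
    digitLaw q s = ∑ i : Fin q, (q : ℝ≥0∞)⁻¹ * s.indicator 1 i := by
  classical
  unfold digitLaw
  rw [PMF.toMeasure_apply_fintype]
  refine Finset.sum_congr rfl fun i _ => ?_
  by_cases h : i ∈ s <;> simp [Set.indicator, h, PMF.uniformOfFintype_apply]

theorem digitSum_summable (q b : ℕ) (hb : 2 ≤ b) (d : ℕ → Fin q) :
    Summable fun k : ℕ => ((d k : ℕ) : ℝ) / (b : ℝ) ^ (k + 1) := by
  have hb' : (1 : ℝ) < b := by exact_mod_cast hb
  have h1 : Summable fun k : ℕ => (q : ℝ) * ((b : ℝ)⁻¹ ^ (k + 1)) := by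
    refine Summable.mul_left _ ?_
    exact (summable_nat_add_iff 1).2
      (summable_geometric_of_lt_one (by positivity) (inv_lt_one_of_one_lt₀ hb'))
  refine Summable.of_nonneg_of_le (fun k => by positivity) (fun k => ?_) h1
  rw [div_eq_mul_inv, inv_pow]
  gcongr
  exact (d k).2.le

theorem measurable_digitSum (q b : ℕ) (hb : 2 ≤ b) : Measurable (digitSum q b) := by
  have h : ∀ n : ℕ, Measurable fun d : ℕ → Fin q =>
      ∑ k ∈ Finset.range n, ((d k : ℕ) : ℝ) / (b : ℝ) ^ (k + 1) := by
    intro n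
    refine Finset.measurable_sum _ fun k _ => Measurable.div_const ?_ _
    exact (measurable_of_countable fun x : Fin q => ((x : ℕ) : ℝ)).comp (measurable_pi_apply k)
  refine measurable_of_tendsto_metrizable h ?_
  rw [tendsto_pi_nhds]
  intro d
  exact (digitSum_summable q b hb d).hasSum.tendsto_sum_nat

theorem cantorMeasure_isProbabilityMeasure (q b : ℕ) [NeZero q] (hb : 2 ≤ b) :
    IsProbabilityMeasure (cantorMeasure q b) :=
  Measure.isProbabilityMeasure_map (measurable_digitSum q b hb).aemeasurable

/-- Prepend a digit to a digit sequence. -/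
def consDigit {q : ℕ} (i : Fin q) (d : ℕ → Fin q) : ℕ → Fin q
  | 0 => i
  | k + 1 => d k

theorem measurable_consDigit {q : ℕ} (i : Fin q) : Measurable (consDigit i) := by
  refine measurable_pi_lambda _ fun k => ?_
  cases k with
  | zero => exact measurable_const
  | succ k => exact measurable_pi_apply k

theorem digitSum_consDigit (q b : ℕ) (hb : 2 ≤ b) (i : Fin q) (d : ℕ → Fin q) :
    digitSum q b (consDigit i d) = contraction b i (digitSum q b d) := by
  have hb' : (b : ℝ) ≠ 0 := by positivity
  unfold digitSum contraction
  rw [(digitSum_summable q b hb (consDigit i d)).tsum_eq_zero_add, add_div, ← tsum_div_const,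
    add_comm]
  congr 1
  · refine tsum_congr fun k => ?_
    simp only [consDigit]
    rw [div_div, ← pow_succ]
  · simp [consDigit]

theorem infinitePi_digitLaw_eq_sum (q : ℕ) [NeZero q] :
    Measure.infinitePi (fun _ : ℕ => digitLaw q) =
      ∑ i : Fin q, (q : ℝ≥0∞)⁻¹ •
        (Measure.infinitePi (fun _ : ℕ => digitLaw q)).map (consDigit i) := by
  classical
  symm
  refine Measure.eq_infinitePi _ fun s t ht => ?_
  obtain ⟨N, hN⟩ : ∃ N : ℕ, s ⊆ Finset.range (N + 1) :=
    ⟨s.sup id, fun x hx => Finset.mem_range.2 (Nat.lt_succ_of_le (Finset.le_sup (f := id) hx))⟩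
  set u : ℕ → Set (Fin q) := fun n => if n ∈ s then t n else Set.univ with hu
  have hum : ∀ n, MeasurableSet (u n) := fun n => Set.Finite.measurableSet (Set.toFinite _)
  have hset : (Set.pi (s : Set ℕ) t) = Set.pi (Finset.range (N + 1) : Set ℕ) u := by
    ext d
    simp only [Set.mem_pi, Finset.mem_coe, hu]
    constructor
    · intro h n _
      split_ifs with hn
      · exact h n hn
      · trivial
    · intro h n hn
      have := h n (hN hn)
      rwa [if_pos hn] at this
  have hprod : ∏ n ∈ s, digitLaw q (t n) = ∏ n ∈ Finset.range (N + 1), digitLaw q (u n) := by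
    rw [← Finset.prod_subset hN]
    · exact Finset.prod_congr rfl fun n hn => by simp [hu, hn]
    · intro n _ hn
      simp [hu, hn]
  rw [hprod, Finset.prod_range_succ', digitLaw_apply q (u 0), hset, Finset.mul_sum]
  simp only [Measure.coe_finsetSum, Finset.sum_apply, Measure.smul_apply, smul_eq_mul]
  refine Finset.sum_congr rfl fun i _ => ?_
  rw [Measure.map_apply (measurable_consDigit i)
    (MeasurableSet.pi (Finset.countable_toSet _) fun n _ => hum n)]
  have hpre : consDigit i ⁻¹' Set.pi (Finset.range (N + 1) : Set ℕ) u =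
      if i ∈ u 0 then Set.pi (Finset.range N : Set ℕ) (fun n => u (n + 1)) else ∅ := by
    ext d
    split_ifs with h0
    · simp only [Set.mem_preimage, Set.mem_pi, Finset.mem_coe, Finset.mem_range]
      constructor
      · intro h n hn
        exact h (n + 1) (by omega)
      · intro h n hn
        cases n with
        | zero => exact h0
        | succ n => exact h n (by omega)
    · simp only [Set.mem_preimage, Set.mem_pi, Finset.mem_coe, Finset.mem_range,
        Set.mem_empty_iff_false, iff_false]
      exact fun h => h0 (h 0 (by omega))
  rw [hpre]
  split_ifs with h0
  · rw [Measure.infinitePi_pi _ fun n _ => hum (n + 1)]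
    simp only [Set.indicator, h0, if_true, Pi.one_apply, mul_one]
    ring
  · simp [Set.indicator, h0]

/-- `μ(E) = ∑_{0 ≤ i < q} (1/q) μ(f_i⁻¹(E))` for all Borel sets `E`. -/
theorem cantorMeasure_selfSimilar (q b : ℕ) [NeZero q] (hb : 2 ≤ b) (E : Set ℝ)
    (hE : MeasurableSet E) :
    cantorMeasure q b E =
      ∑ i : Fin q, (q : ℝ≥0∞)⁻¹ * cantorMeasure q b (contraction b i ⁻¹' E) := by
  have hc : ∀ i : Fin q, Measurable (contraction b i) := fun i => by
    unfold contraction; fun_prop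
  have hS := measurable_digitSum q b hb
  unfold cantorMeasure
  conv_lhs => rw [infinitePi_digitLaw_eq_sum q]
  rw [Measure.map_apply hS hE]
  simp only [Measure.coe_finsetSum, Finset.sum_apply, Measure.smul_apply, smul_eq_mul]
  refine Finset.sum_congr rfl fun i _ => ?_
  rw [Measure.map_apply (measurable_consDigit i) (hS hE), Measure.map_apply hS (hc i hE)]
  congr 2
  ext d
  simp [digitSum_consDigit q b hb]

/-! ### Spectra -/

/-- `Λ` is a spectrum of `L²(μ)`: a countable set of real numbers such that the exponentials
`x ↦ e^{2πiλx}`, `λ ∈ Λ`, form an orthonormal basis of `L²(μ)`. -/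
def IsSpectrum (μ : Measure ℝ) (Λ : Set ℝ) : Prop :=
  Λ.Countable ∧ ∃ B : HilbertBasis Λ ℂ (Lp ℂ 2 μ), ∀ l : Λ,
    (B l : ℝ → ℂ) =ᵐ[μ] fun x : ℝ => Complex.exp (2 * Real.pi * Complex.I * ((l : ℝ) : ℂ) * x)

/-! ### The `q`-adic tree

A finite word `σ₁⋯σ_k` is the list `[σ₁, …, σ_k]`, the root is `[]`; an infinite word
`ω₁ω₂⋯` is the sequence `ω` with `ω k` its letter number `k + 1`. -/

/-- The infinite word `σ0^∞`. -/
def zeroExtend {q : ℕ} [NeZero q] (σ : List (Fin q)) : ℕ → Fin q := fun k => σ.getD k 0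

/-- The initial segment `ω|_k` of length `k`. -/
def prefixWord {q : ℕ} (ω : ℕ → Fin q) (k : ℕ) : List (Fin q) := List.ofFn fun i : Fin k => ω i

/-- `Γ_q`, the set of infinite words that end in `0^∞`. (Dropping the trailing zeros of `σ`, one
may take `σ` in `σ0^∞` empty or with a nonzero last letter.) -/
def Gam (q : ℕ) [NeZero q] : Set (ℕ → Fin q) := Set.range zeroExtend

/-- `τ` is regular on `ω`: `τ(ω|_k) = 0` for all sufficiently large `k`. -/
def IsRegularOn {q : ℕ} (τ : List (Fin q) → ℤ) (ω : ℕ → Fin q) : Prop :=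
  ∀ᶠ k : ℕ in atTop, τ (prefixWord ω k) = 0

/-- `Π_b^τ(ω) = ∑_{k ≥ 1} τ(ω|_k) b^{k-1}`, a finite sum if `τ` is regular on `ω`. -/
noncomputable def proj {q : ℕ} (b : ℕ) (τ : List (Fin q) → ℤ) (ω : ℕ → Fin q) : ℝ :=
  ∑' k : ℕ, (τ (prefixWord ω (k + 1)) : ℝ) * (b : ℝ) ^ k

/-- `Λ(τ) = {Π_b^τ(ω) : ω ∈ Γ_q, τ regular on ω}`. -/
def Lam {q : ℕ} [NeZero q] (b : ℕ) (τ : List (Fin q) → ℤ) : Set ℝ :=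
  {x | ∃ ω ∈ Gam q, IsRegularOn τ ω ∧ x = proj b τ ω}

/-- Maximal mappings `τ : Σ_q^* → {-1, 0, …, b - 2}`. -/
structure IsMaximalMapping {q : ℕ} [NeZero q] (b : ℕ) (τ : List (Fin q) → ℤ) : Prop where
  /-- all values lie in `{-1, 0, …, b - 2}` -/
  mem_digits : ∀ σ, τ σ ∈ Set.Icc (-1 : ℤ) ((b : ℤ) - 2)
  /-- `τ(ϑ) = τ(0^n) = 0` for all `n ≥ 1` -/
  zero_word : ∀ n : ℕ, τ (List.replicate n 0) = 0
  /-- `τ(σ₁⋯σ_k) ≡ σ_k` modulo `q` for all `k ≥ 1` -/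
  modEq_last : ∀ (σ : List (Fin q)) (i : Fin q), τ (σ ++ [i]) ≡ ((i : ℕ) : ℤ) [ZMOD (q : ℤ)]
  /-- every finite word `σ` has an extension `σσ'` such that `τ` is regular on `σσ'0^∞` -/
  exists_regular : ∀ σ : List (Fin q), ∃ σ' : List (Fin q), IsRegularOn τ (zeroExtend (σ ++ σ'))

/-- `τ` is a spectral mapping: a maximal mapping such that, with `b = qr`, the set `rΛ(τ)` is a
spectrum of `L²(μ_{q,b})`. -/
def IsSpectralMapping {q : ℕ} [NeZero q] (r : ℕ) (τ : List (Fin q) → ℤ) : Prop :=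
  IsMaximalMapping (q * r) τ ∧
    IsSpectrum (cantorMeasure q (q * r)) ((fun x : ℝ => (r : ℝ) * x) '' Lam (q * r) τ)

open Classical in
/-- The mapping `τ'`: equal to `0` at the words `I0^ℓ`, `ℓ ≥ 1`, and to `τ` elsewhere. -/
noncomputable def zeroAlong {q : ℕ} [NeZero q] (τ : List (Fin q) → ℤ) (I : List (Fin q)) :
    List (Fin q) → ℤ := fun σ =>
  if ∃ l : ℕ, 1 ≤ l ∧ σ = I ++ List.replicate l 0 then 0 else τ σ

end CantorSpectra

namespace CantorSpectra

/-! ### The mask of the digit set -/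

/-! Write e_ξ for the exponential of frequency ξ, and W_g(ξ) (`wordSum`) for the sum of |μ̂(ξ +
rλ)|² over the projections λ of the regular words of g. The congruence modulo q makes the e_{rλ}
orthonormal, so W_g(ξ) ≤ 1 is Bessel's inequality for e_{-ξ}, and rΛ(g) is a spectrum exactly when
W_g is identically 1 (`isSpectrum_iff_wordSum_eq_one`), which is what `IsComplete` expresses. This
uses only the digit range and the congruence, which pass to subtrees.

Self-similarity of μ gives a recursion for the defect 1 - W_g: it is an average, with mask weights
summing to one, of the defects of the subtrees at rescaled frequencies (`defect_eq_sum`). Since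
defects are nonnegative and the mask vanishes only on a countable set, g is complete if and only if
all its first-level subtrees are (`isComplete_iff_forall_subtree`). Descending along I reduces the
claim to two mappings that differ only along the branch of zeros.

It remains to see that completeness ignores the values on that branch
(`isComplete_iff_forall_subtree_zeroTail`). If every subtree hanging off the branch is complete, the
recursion keeps one term per level, and the defect becomes a product of masks along an orbit x_n
times the defect of a tail. If the digits on the branch are eventually 0, then x_n → 0 and the
contribution of 0^∞ forces the tail defect to 0. Otherwise infinitely many masks are bounded by a
constant below 1, and the product tends to 0. -/

/-- The character `e^{2πiy}`. -/
noncomputable def phase (y : ℝ) : ℂ := Complex.exp (2 * Real.pi * Complex.I * y)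

theorem phase_add (x y : ℝ) : phase (x + y) = phase x * phase y := by
  unfold phase
  rw [← Complex.exp_add]
  push_cast
  ring_nf

theorem phase_eq_one_iff (y : ℝ) : phase y = 1 ↔ ∃ n : ℤ, y = n := by
  unfold phase
  rw [Complex.exp_eq_one_iff]
  have hπ : (2 * Real.pi * Complex.I : ℂ) ≠ 0 := Complex.two_pi_I_ne_zero
  refine exists_congr fun n => ?_
  rw [mul_comm (n : ℂ), mul_right_inj' hπ]
  norm_cast

theorem phase_int (n : ℤ) : phase n = 1 := (phase_eq_one_iff _).2 ⟨n, rfl⟩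

theorem phase_natCast_mul (n : ℕ) (y : ℝ) : phase (n * y) = phase y ^ n := by
  unfold phase
  rw [← Complex.exp_nat_mul]
  push_cast
  ring_nf

theorem norm_phase (y : ℝ) : ‖phase y‖ = 1 := by
  unfold phase
  rw [show (2 * Real.pi * Complex.I * y : ℂ) = ((2 * Real.pi * y : ℝ) : ℂ) * Complex.I by
    push_cast; ring]
  exact Complex.norm_exp_ofReal_mul_I _

theorem conj_phase (y : ℝ) : (starRingEnd ℂ) (phase y) = phase (-y) := by
  unfold phase
  rw [← Complex.exp_conj]
  simp [Complex.conj_ofNat]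

theorem continuous_phase : Continuous phase := by
  unfold phase
  fun_prop

/-- The squared modulus of the Fourier transform of the uniform law on the digits
`0, …, q - 1`. -/
noncomputable def mask (q : ℕ) (x : ℝ) : ℝ :=
  ‖(q : ℂ)⁻¹ * ∑ i : Fin q, phase ((i : ℕ) * x)‖ ^ 2

theorem mask_nonneg (q : ℕ) (x : ℝ) : 0 ≤ mask q x := by
  unfold mask
  positivity

theorem continuous_mask (q : ℕ) : Continuous (mask q) := by
  unfold mask
  have := continuous_phase
  fun_prop

theorem mask_add_int (q : ℕ) (x : ℝ) (n : ℤ) : mask q (x + n) = mask q x := by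
  unfold mask
  congr 4 with i
  rw [mul_add, phase_add]
  have := phase_int ((i : ℕ) * n)
  push_cast at this
  rw [this, mul_one]

theorem sum_phase_eq_geom_sum (q : ℕ) (x : ℝ) :
    ∑ i : Fin q, phase ((i : ℕ) * x) = ∑ i ∈ Finset.range q, phase x ^ i := by
  rw [← Fin.sum_univ_eq_sum_range]
  simp only [phase_natCast_mul]

theorem mask_le_one (q : ℕ) [NeZero q] (x : ℝ) : mask q x ≤ 1 := by
  have hq : (0 : ℝ) < q := by exact_mod_cast Nat.pos_of_ne_zero (NeZero.ne q)
  unfold mask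
  refine pow_le_one₀ (norm_nonneg _) ?_
  rw [norm_mul, norm_inv, Complex.norm_natCast, inv_mul_le_iff₀ hq, mul_one]
  refine (norm_sum_le _ _).trans ?_
  simp [norm_phase]

/-- The mask vanishes only on `(1/q)ℤ`. -/
theorem exists_int_of_mask_eq_zero (q : ℕ) [NeZero q] (x : ℝ) (h : mask q x = 0) :
    ∃ n : ℤ, q * x = n := by
  have hq : (q : ℂ) ≠ 0 := by exact_mod_cast NeZero.ne q
  unfold mask at h
  rw [pow_eq_zero_iff two_ne_zero, norm_eq_zero, mul_eq_zero, inv_eq_zero, or_iff_right hq,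
    sum_phase_eq_geom_sum] at h
  rw [← phase_eq_one_iff, phase_natCast_mul]
  have := geom_sum_mul (phase x) q
  rw [h, zero_mul] at this
  exact (sub_eq_zero.1 this.symm)

/-- The mask vanishes on `(1/q)(ℤ ∖ qℤ)`. -/
theorem mask_eq_zero (q : ℕ) [NeZero q] (a : ℤ) (ha : ¬ (q : ℤ) ∣ a) : mask q (a / q) = 0 := by
  have hq : (q : ℝ) ≠ 0 := by exact_mod_cast NeZero.ne q
  have h1 : phase (a / q) ≠ 1 := by
    rw [Ne, phase_eq_one_iff]
    rintro ⟨n, hn⟩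
    rw [div_eq_iff hq] at hn
    exact ha ⟨n, by rw [mul_comm]; exact_mod_cast hn⟩
  have h2 : phase (a / q) ^ q = 1 := by
    rw [← phase_natCast_mul, mul_div_cancel₀ _ hq, phase_int]
  have := geom_sum_mul (phase (a / q)) q
  rw [h2, sub_self, mul_eq_zero, or_iff_left (sub_ne_zero.2 h1)] at this
  unfold mask
  rw [sum_phase_eq_geom_sum, this]
  simp

/-- The zeros lie in (1/q)ℤ, and the complement of a countable subset of ℝ is dense. -/
theorem dense_mask_ne_zero (q : ℕ) [NeZero q] : Dense {x : ℝ | mask q x ≠ 0} := by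
  have hq : (q : ℝ) ≠ 0 := by exact_mod_cast NeZero.ne q
  have hc : {x : ℝ | mask q x = 0}.Countable := by
    refine (Set.countable_range fun n : ℤ => (n : ℝ) / q).mono fun x hx => ?_
    obtain ⟨n, hn⟩ := exists_int_of_mask_eq_zero q x hx
    exact ⟨n, by simp only [← hn]; field_simp⟩
  exact hc.dense_compl ℝ

/-- Strictness already comes from the first two summands: |1 + e^{2πix}| = 2 would force e^{2πix} =
1. This is where two digits are needed. -/
theorem mask_lt_one (q : ℕ) (hq : 2 ≤ q) (x : ℝ) (h0 : 0 < x) (h1 : x < 1) : mask q x < 1 := by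
  obtain ⟨p, rfl⟩ := Nat.exists_eq_add_of_le hq
  have hq' : (0 : ℝ) < ((2 + p : ℕ) : ℝ) := by positivity
  have hx : phase x ≠ 1 := by
    rw [Ne, phase_eq_one_iff]
    rintro ⟨n, rfl⟩
    norm_cast at h0 h1
    omega
  have h2 : ‖1 + phase x‖ < 2 := by
    refine lt_of_le_of_ne ((norm_add_le _ _).trans (by rw [norm_phase]; norm_num)) fun h => hx ?_
    have hs : SameRay ℝ (1 : ℂ) (phase x) := by
      rw [sameRay_iff_norm_add, h, norm_phase]
      norm_num
    exact (hs.eq_of_norm_eq (by rw [norm_phase, norm_one])).symm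
  unfold mask
  refine pow_lt_one₀ (norm_nonneg _) ?_ two_ne_zero
  rw [norm_mul, norm_inv, Complex.norm_natCast, inv_mul_lt_iff₀ hq', mul_one,
    sum_phase_eq_geom_sum, Finset.sum_range_add]
  refine (norm_add_le _ _).trans_lt ?_
  rw [Nat.cast_add]
  refine add_lt_add_of_lt_of_le ?_ ?_
  · simpa [Finset.sum_range_succ] using h2
  · refine (norm_sum_le _ _).trans ?_
    simp [norm_phase]

/-- The mask sums to one over the shifts by `j/q`, `j` in a complete residue system. -/
theorem sum_mask_eq_one (q : ℕ) [NeZero q] (x : ℝ) (n : Fin q → ℤ)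
    (hn : ∀ j, n j ≡ ((j : ℕ) : ℤ) [ZMOD (q : ℤ)]) : ∑ j, mask q (x + n j / q) = 1 := by
  have hq : (q : ℝ) ≠ 0 := by exact_mod_cast NeZero.ne q
  have hqc : (q : ℂ) ≠ 0 := by exact_mod_cast NeZero.ne q
  have h1 : ∀ j, mask q (x + n j / q) = mask q (x + (j : ℕ) / q) := fun j => by
    obtain ⟨t, ht⟩ := (hn j).symm.dvd
    rw [← mask_add_int q (x + (j : ℕ) / q) t]
    congr 1
    have ht' : (n j : ℝ) = (j : ℕ) + q * t := by
      have : n j = (j : ℕ) + q * t := by linarith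
      exact_mod_cast this
    rw [ht']
    field_simp
    ring
  -- Orthogonality of the characters of ℤ/q; after the square is expanded, only the q diagonal terms
  -- survive.
  have horth : ∀ i k : Fin q,
      ∑ j : Fin q, phase (((i : ℕ) - (k : ℕ)) * ((j : ℕ) / q)) = if i = k then (q : ℂ) else 0 := by
    intro i k
    have h3 : ∀ j : Fin q, phase (((i : ℕ) - (k : ℕ)) * ((j : ℕ) / q)) =
        phase ((j : ℕ) * ((((i : ℕ) - (k : ℕ) : ℤ) : ℝ) / q)) := fun j => by
      congr 1
      push_cast
      ring
    simp only [h3]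
    rw [sum_phase_eq_geom_sum]
    split_ifs with hik
    · subst hik
      have : phase 0 = 1 := by simpa using phase_int 0
      simp [this]
    · have hne : phase ((((i : ℕ) - (k : ℕ) : ℤ) : ℝ) / q) ≠ 1 := by
        rw [Ne, phase_eq_one_iff]
        rintro ⟨m, hm⟩
        rw [div_eq_iff hq] at hm
        have hm' : ((i : ℕ) - (k : ℕ) : ℤ) = m * q := by exact_mod_cast hm
        have hi := i.2
        have hk := k.2
        have hmz : m = 0 := by
          rcases lt_trichotomy m 0 with h | h | h
          · nlinarith
          · exact h
          · nlinarith
        rw [hmz] at hm'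
        exact hik (Fin.ext (by omega))
      have h2 : phase ((((i : ℕ) - (k : ℕ) : ℤ) : ℝ) / q) ^ q = 1 := by
        rw [← phase_natCast_mul, mul_div_cancel₀ _ hq, phase_int]
      have := geom_sum_mul (phase ((((i : ℕ) - (k : ℕ) : ℤ) : ℝ) / q)) q
      rwa [h2, sub_self, mul_eq_zero, or_iff_left (sub_ne_zero.2 hne)] at this
  have h2 : ∀ y : ℝ, ((mask q y : ℝ) : ℂ) =
      ((q : ℂ)⁻¹) ^ 2 * ∑ i : Fin q, ∑ k : Fin q, phase (((i : ℕ) - (k : ℕ)) * y) := by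
    intro y
    unfold mask
    rw [Complex.ofReal_pow, ← Complex.mul_conj', map_mul, map_sum, map_inv₀, Complex.conj_natCast,
      mul_mul_mul_comm, ← sq, Finset.sum_mul_sum]
    congr 1
    refine Finset.sum_congr rfl fun i _ => Finset.sum_congr rfl fun k _ => ?_
    rw [conj_phase, ← phase_add]
    congr 1
    ring
  have h4 : ((∑ j, mask q (x + n j / q) : ℝ) : ℂ) = 1 := by
    simp only [h1]
    rw [Complex.ofReal_sum]
    simp only [h2]
    rw [← Finset.mul_sum, Finset.sum_comm]
    have : ∀ i : Fin q, ∑ j : Fin q, ∑ k : Fin q,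
        phase (((i : ℕ) - (k : ℕ)) * (x + (j : ℕ) / q)) = q := by
      intro i
      rw [Finset.sum_comm]
      simp only [mul_add, phase_add, ← Finset.mul_sum]
      simp only [horth]
      have : phase 0 = 1 := by simpa using phase_int 0
      simp [this]
    rw [Finset.sum_congr rfl fun i _ => this i]
    simp
    field_simp
  exact_mod_cast h4

/-! ### Orthonormal families and exponentials in `L²(μ)` -/

/-- Equality in Bessel's inequality characterizes the closed span of an orthonormal family. -/
theorem tsum_ofReal_norm_inner_sq_eq_iff {ι H : Type*} [NormedAddCommGroup H]
    [InnerProductSpace ℂ H] [CompleteSpace H] {v : ι → H} (hv : Orthonormal ℂ v) (x : H) :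
    ∑' i, ENNReal.ofReal (‖inner ℂ (v i) x‖ ^ 2) = ENNReal.ofReal (‖x‖ ^ 2) ↔
      x ∈ (Submodule.span ℂ (Set.range v)).topologicalClosure := by
  classical
  have hs := hv.inner_products_summable x
  rw [← ENNReal.ofReal_tsum_of_nonneg (fun i => by positivity) hs,
    ENNReal.ofReal_eq_ofReal_iff (tsum_nonneg fun i => by positivity) (by positivity)]
  constructor
  · intro h
    have hsum := hs.hasSum
    rw [h] at hsum
    -- Pythagoras for partial sums: if Bessel is an equality, the residuals tend to 0 and x is a
    -- limit of elements of the span.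
    have hP : ∀ s : Finset ι, ‖∑ i ∈ s, inner ℂ (v i) x • v i - x‖ ^ 2 =
        ‖x‖ ^ 2 - ∑ i ∈ s, ‖inner ℂ (v i) x‖ ^ 2 := by
      intro s
      have h1 : ‖∑ i ∈ s, inner ℂ (v i) x • v i‖ ^ 2 = ∑ i ∈ s, ‖inner ℂ (v i) x‖ ^ 2 := by
        have h := hv.inner_sum (fun i => inner ℂ (v i) x) (fun i => inner ℂ (v i) x) s
        rw [inner_self_eq_norm_sq_to_K] at h
        simp only [RCLike.conj_mul] at h
        exact_mod_cast h
      have h2 : RCLike.re (inner ℂ (∑ i ∈ s, inner ℂ (v i) x • v i) x) =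
          ∑ i ∈ s, ‖inner ℂ (v i) x‖ ^ 2 := by
        rw [sum_inner, map_sum]
        refine Finset.sum_congr rfl fun i _ => ?_
        rw [inner_smul_left, RCLike.conj_mul]
        norm_cast
      rw [@norm_sub_sq ℂ, h1, h2]
      ring
    have ht : Tendsto (fun s : Finset ι => ∑ i ∈ s, inner ℂ (v i) x • v i) atTop (nhds x) := by
      rw [tendsto_iff_norm_sub_tendsto_zero]
      have h0 : Tendsto (fun s : Finset ι => ‖∑ i ∈ s, inner ℂ (v i) x • v i - x‖ ^ 2) atTop
          (nhds 0) := by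
        simp only [hP]
        have h1 := Tendsto.const_sub (‖x‖ ^ 2) hsum
        rwa [sub_self] at h1
      simpa using h0.sqrt
    refine mem_closure_of_tendsto ht (Eventually.of_forall fun s => ?_)
    exact Submodule.sum_mem _ fun i _ =>
      Submodule.smul_mem _ _ (Submodule.subset_span ⟨i, rfl⟩)
  · intro hx
    -- For the converse, extend to a Hilbert basis and apply Parseval; the added vectors are
    -- orthogonal to the closed span, hence contribute nothing.
    obtain ⟨w, B, hw, hB⟩ := hv.toSubtypeRange.exists_hilbertBasis_extension
    have hBo : Orthonormal ℂ ((↑) : w → H) := hB ▸ B.orthonormal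
    have hsum : HasSum (fun u : w => ‖inner ℂ (u : H) x‖ ^ 2) (‖x‖ ^ 2) := by
      have h := B.hasSum_inner_mul_inner x x
      rw [hB, inner_self_eq_norm_sq_to_K] at h
      have h' := RCLike.hasSum_re ℂ h
      convert h' using 1
      · ext u
        rw [← inner_conj_symm, RCLike.norm_conj, RCLike.mul_conj]
        norm_cast
      · norm_cast
    let g : ι → w := fun i => ⟨v i, hw ⟨i, rfl⟩⟩
    have hg : Function.Injective g := fun i j hij =>
      hv.linearIndependent.injective (congrArg Subtype.val hij)
    have h0 : ∀ u ∉ Set.range g, ‖inner ℂ (u : H) x‖ ^ 2 = 0 := by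
      intro u hu
      have hle : (Submodule.span ℂ (Set.range v)).topologicalClosure ≤
          (Submodule.span ℂ {(u : H)})ᗮ := by
        refine Submodule.topologicalClosure_minimal _ (Submodule.span_le.2 ?_)
          (Submodule.isClosed_orthogonal _)
        rintro _ ⟨i, rfl⟩
        rw [SetLike.mem_coe, Submodule.mem_orthogonal_singleton_iff_inner_right]
        exact hBo.2 (i := u) (j := g i) fun h => hu ⟨i, h.symm⟩
      rw [(Submodule.mem_orthogonal_singleton_iff_inner_right).1 (hle hx)]
      simp
    exact ((hg.hasSum_iff h0).2 hsum).tsum_eq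

/-- A real integrable function all of whose Fourier coefficients vanish is zero. -/
theorem ae_eq_zero_of_forall_integral_exp {μ : Measure ℝ} [IsFiniteMeasure μ] {u : ℝ → ℝ}
    (hu : Integrable u μ)
    (h : ∀ t : ℝ, ∫ x, (u x : ℂ) * Complex.exp (t * x * Complex.I) ∂μ = 0) : u =ᵐ[μ] 0 := by
  have hexp : ∀ t x : ℝ, ‖Complex.exp (t * x * Complex.I)‖ = 1 := fun t x => by
    rw [← Complex.ofReal_mul]
    exact Complex.norm_exp_ofReal_mul_I _
  have hfin : ∀ {w : ℝ → ℝ}, Integrable w μ →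
      IsFiniteMeasure (μ.withDensity fun x => ENNReal.ofReal (w x)) := fun hw =>
    isFiniteMeasure_withDensity_ofReal hw.2
  have hchar : ∀ {w : ℝ → ℝ}, Integrable w μ → ∀ t : ℝ,
      charFun (μ.withDensity fun x => ENNReal.ofReal (w x)) t =
        ∫ x, ((max (w x) 0 : ℝ) : ℂ) * Complex.exp (t * x * Complex.I) ∂μ := by
    intro w hw t
    rw [charFun_apply_real, integral_withDensity_eq_integral_toReal_smul₀
      hw.aemeasurable.ennreal_ofReal (by simp)]
    simp only [ENNReal.toReal_ofReal', Complex.real_smul]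
  have hint : ∀ {w : ℝ → ℝ}, Integrable w μ → ∀ t : ℝ,
      Integrable (fun x => ((max (w x) 0 : ℝ) : ℂ) * Complex.exp (t * x * Complex.I)) μ := by
    intro w hw t
    refine (hw.pos_part.ofReal (𝕜 := ℂ)).mul_bdd (c := 1) (by fun_prop) ?_
    exact ae_of_all _ fun x => (hexp t x).le
  have := hfin hu
  have := hfin hu.neg
  -- The densities u⁺ and u⁻ define finite measures with the same characteristic function, so they
  -- agree almost everywhere; at each point one of them is 0, hence both are.
  have heq : (μ.withDensity fun x => ENNReal.ofReal (u x)) =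
      μ.withDensity fun x => ENNReal.ofReal ((-u) x) := by
    refine Measure.ext_of_charFun (funext fun t => ?_)
    rw [hchar hu, hchar hu.neg, ← sub_eq_zero, ← integral_sub (hint hu t) (hint hu.neg t), ← h t]
    refine integral_congr_ae (ae_of_all _ fun x => ?_)
    simp only [← sub_mul, Pi.neg_apply]
    congr 1
    rw [← Complex.ofReal_sub]
    congr 1
    rcases le_total 0 (u x) with h0 | h0 <;> simp [h0]
  rw [withDensity_eq_iff_of_sigmaFinite hu.aemeasurable.ennreal_ofReal
    hu.neg.aemeasurable.ennreal_ofReal] at heq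
  filter_upwards [heq] with x hx
  simp only [Pi.neg_apply] at hx
  rcases le_total 0 (u x) with h0 | h0
  · rw [ENNReal.ofReal_of_nonpos (neg_nonpos.2 h0)] at hx
    exact le_antisymm (ENNReal.ofReal_eq_zero.1 hx) h0
  · rw [ENNReal.ofReal_of_nonpos h0] at hx
    exact le_antisymm h0 (neg_nonpos.1 (ENNReal.ofReal_eq_zero.1 hx.symm))

/-- The exponential `x ↦ e^{2πiξx}` as an element of `L²(μ)`. -/
noncomputable def expLp (μ : Measure ℝ) [IsFiniteMeasure μ] (ξ : ℝ) : Lp ℂ 2 μ :=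
  BoundedContinuousFunction.toLp 2 μ ℂ
    (BoundedContinuousFunction.innerProbChar (2 * Real.pi * ξ))

section expLp

variable (μ : Measure ℝ) [IsProbabilityMeasure μ]

theorem coeFn_expLp (ξ : ℝ) : (expLp μ ξ : ℝ → ℂ) =ᵐ[μ]
    fun x : ℝ => Complex.exp (2 * Real.pi * Complex.I * (ξ : ℂ) * x) := by
  filter_upwards [BoundedContinuousFunction.coeFn_toLp 2 μ ℂ
    (BoundedContinuousFunction.innerProbChar (2 * Real.pi * ξ))] with x hx
  rw [expLp, hx, BoundedContinuousFunction.innerProbChar_apply]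
  simp
  ring_nf

theorem inner_expLp_left (ξ : ℝ) (f : Lp ℂ 2 μ) :
    inner ℂ (expLp μ ξ) f =
      ∫ x, f x * Complex.exp (((2 * Real.pi * -ξ : ℝ) : ℂ) * x * Complex.I) ∂μ := by
  rw [L2.inner_def]
  refine integral_congr_ae ?_
  filter_upwards [coeFn_expLp μ ξ] with x hx
  rw [hx, RCLike.inner_apply, ← Complex.exp_conj]
  congr 2
  simp [Complex.conj_ofNat]
  ring

theorem inner_expLp (ξ η : ℝ) :
    inner ℂ (expLp μ ξ) (expLp μ η) = charFun μ (2 * Real.pi * (η - ξ)) := by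
  rw [inner_expLp_left, charFun_apply_real]
  refine integral_congr_ae ?_
  filter_upwards [coeFn_expLp μ η] with x hx
  rw [hx, ← Complex.exp_add]
  push_cast
  ring_nf

theorem norm_expLp (ξ : ℝ) : ‖expLp μ ξ‖ = 1 := by
  have h := inner_expLp μ ξ ξ
  rw [inner_self_eq_norm_sq_to_K, sub_self, mul_zero, charFun_zero, probReal_univ] at h
  have h' : ‖expLp μ ξ‖ ^ 2 = 1 := by
    rw [← Complex.ofReal_inj, Complex.ofReal_pow]
    exact h
  exact (pow_eq_one_iff_of_nonneg (norm_nonneg _) two_ne_zero).1 h'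

/-- The squared distance between e_η and e_ξ is 2 - 2 Re μ̂ at their difference, and μ̂ is
continuous. -/
theorem continuous_expLp : Continuous (expLp μ) := by
  rw [continuous_iff_continuousAt]
  intro ξ
  rw [ContinuousAt, tendsto_iff_norm_sub_tendsto_zero]
  have h : ∀ η, ‖expLp μ η - expLp μ ξ‖ =
      √(2 - 2 * (charFun μ (2 * Real.pi * (ξ - η))).re) := fun η => by
    rw [← Real.sqrt_sq (norm_nonneg _), @norm_sub_sq ℂ, norm_expLp, norm_expLp, inner_expLp]
    congr 1
    simp
    ring
  simp only [h]
  have hc : Continuous fun η : ℝ => √(2 - 2 * (charFun μ (2 * Real.pi * (ξ - η))).re) := by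
    have := continuous_charFun (μ := μ)
    fun_prop
  have := hc.tendsto ξ
  simpa using this

/-- The exponentials span a dense subspace of `L²(μ)`. -/
theorem span_range_expLp_dense :
    (Submodule.span ℂ (Set.range (expLp μ))).topologicalClosure = ⊤ := by
  rw [Submodule.topologicalClosure_eq_top_iff, Submodule.eq_bot_iff]
  intro f hf
  have hf0 : ∀ t : ℝ, ∫ x, f x * Complex.exp (t * x * Complex.I) ∂μ = 0 := by
    intro t
    have h := (Submodule.mem_orthogonal _ _).1 hf (expLp μ (-(t / (2 * Real.pi))))
      (Submodule.subset_span ⟨_, rfl⟩)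
    rw [inner_expLp_left, neg_neg, mul_div_cancel₀ _ (by positivity)] at h
    exact h
  have hfi : Integrable f μ := (Lp.memLp f).integrable (by norm_num)
  have hbdd : ∀ t : ℝ, Integrable (fun x => f x * Complex.exp (t * x * Complex.I)) μ := fun t => by
    refine hfi.mul_bdd (c := 1) (by fun_prop) (ae_of_all _ fun x => ?_)
    rw [← Complex.ofReal_mul, Complex.norm_exp_ofReal_mul_I]
  -- The condition on f holds for t and -t alike, so it passes to the conjugate, and thus to the
  -- real and imaginary parts.
  have hconj : ∀ t : ℝ,
      ∫ x, (starRingEnd ℂ) (f x) * Complex.exp (t * x * Complex.I) ∂μ = 0 := by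
    intro t
    have h := congrArg (starRingEnd ℂ) (hf0 (-t))
    rw [← integral_conj, map_zero] at h
    rw [← h]
    refine integral_congr_ae (ae_of_all _ fun x => ?_)
    simp [← Complex.exp_conj]
  have hbddc : ∀ t : ℝ,
      Integrable (fun x => (starRingEnd ℂ) (f x) * Complex.exp (t * x * Complex.I)) μ := fun t => by
    refine Integrable.mul_bdd (c := 1) ?_ (by fun_prop) (ae_of_all _ fun x => ?_)
    · exact (Complex.conjCLE.integrable_comp_iff).2 hfi
    · rw [← Complex.ofReal_mul, Complex.norm_exp_ofReal_mul_I]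
  have hre : (fun x => (f x).re) =ᵐ[μ] 0 := by
    refine ae_eq_zero_of_forall_integral_exp hfi.re fun t => ?_
    have h := integral_add (hbdd t) (hbddc t)
    rw [hf0, hconj, add_zero] at h
    rw [← mul_eq_zero_iff_left (two_ne_zero (α := ℂ)), ← integral_const_mul, ← h]
    refine integral_congr_ae (ae_of_all _ fun x => ?_)
    simp only [← add_mul, Complex.add_conj]
    push_cast
    ring
  have him : (fun x => (f x).im) =ᵐ[μ] 0 := by
    refine ae_eq_zero_of_forall_integral_exp hfi.im fun t => ?_
    have h := integral_sub (hbdd t) (hbddc t)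
    rw [hf0, hconj, sub_zero] at h
    have h2 : (2 * Complex.I : ℂ) ≠ 0 := by simp
    rw [← mul_eq_zero_iff_left h2, ← integral_const_mul, ← h]
    refine integral_congr_ae (ae_of_all _ fun x => ?_)
    simp only [← sub_mul, Complex.sub_conj]
    push_cast
    ring
  rw [Lp.eq_zero_iff_ae_eq_zero]
  filter_upwards [hre, him] with x h1 h2
  exact Complex.ext h1 h2

/-- Orthonormal exponentials form a spectrum if and only if their closed span contains all
exponentials. -/
theorem isSpectrum_range_iff {ι : Type*} [Countable ι] {l : ι → ℝ} (hl : Function.Injective l)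
    (ho : Orthonormal ℂ fun i => expLp μ (l i)) :
    IsSpectrum μ (Set.range l) ↔ ∀ ξ, expLp μ ξ ∈
      (Submodule.span ℂ (Set.range fun i => expLp μ (l i))).topologicalClosure := by
  have hr : (Set.range fun x : Set.range l => expLp μ x) = Set.range fun i => expLp μ (l i) := by
    ext f
    simp
  constructor
  · rintro ⟨-, B, hB⟩ ξ
    have h : (B : Set.range l → Lp ℂ 2 μ) = fun x : Set.range l => expLp μ x := by
      ext1 x
      exact Lp.ext ((hB x).trans (coeFn_expLp μ x).symm)
    have hd := B.dense_span
    rw [h, hr] at hd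
    rw [hd]
    trivial
  · intro h
    refine ⟨Set.countable_range l, ?_⟩
    have ho' : Orthonormal ℂ fun x : Set.range l => expLp μ x := by
      have := ho.comp (Equiv.ofInjective l hl).symm (Equiv.injective _)
      convert this using 1
      ext1 x
      simp [Function.comp, Equiv.apply_ofInjective_symm hl]
    have hd : ⊤ ≤ (Submodule.span ℂ
        (Set.range fun x : Set.range l => expLp μ x)).topologicalClosure := by
      rw [hr, ← span_range_expLp_dense μ]
      refine Submodule.topologicalClosure_minimal _ (Submodule.span_le.2 ?_)
        (Submodule.isClosed_topologicalClosure _)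
      rintro _ ⟨ξ, rfl⟩
      exact h ξ
    refine ⟨HilbertBasis.mk ho' hd, fun x => ?_⟩
    rw [HilbertBasis.coe_mk]
    exact coeFn_expLp μ x

end expLp

/-! ### The squared modulus of the Fourier transform of the measure -/

/-- The squared modulus of the Fourier transform of `μ_{q,b}`. -/
noncomputable def fourierSq (q b : ℕ) [NeZero q] (ξ : ℝ) : ℝ :=
  ‖charFun (cantorMeasure q b) (2 * Real.pi * ξ)‖ ^ 2

section fourierSq

variable {q b : ℕ} [NeZero q]

theorem fourierSq_neg (ξ : ℝ) : fourierSq q b (-ξ) = fourierSq q b ξ := by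
  unfold fourierSq
  rw [mul_neg, charFun_neg, RCLike.norm_conj]

theorem fourierSq_zero (hb : 2 ≤ b) : fourierSq q b 0 = 1 := by
  have := cantorMeasure_isProbabilityMeasure q b hb
  simp [fourierSq]

theorem continuous_fourierSq (hb : 2 ≤ b) : Continuous (fourierSq q b) := by
  have := cantorMeasure_isProbabilityMeasure q b hb
  have := continuous_charFun (μ := cantorMeasure q b)
  unfold fourierSq
  fun_prop

theorem cantorMeasure_eq_sum_map (hb : 2 ≤ b) : cantorMeasure q b =
    ∑ i : Fin q, (q : ℝ≥0∞)⁻¹ • (cantorMeasure q b).map (contraction b i) := by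
  ext E hE
  rw [cantorMeasure_selfSimilar q b hb E hE]
  simp only [Measure.coe_finsetSum, Finset.sum_apply, Measure.smul_apply, smul_eq_mul]
  refine Finset.sum_congr rfl fun i _ => ?_
  rw [Measure.map_apply (by unfold contraction; fun_prop) hE]

/-- Fourier form of self-similarity: each map x ↦ (x + i)/b contributes a phase times μ̂(ξ/b), and
averaging the phases gives the mask. -/
theorem fourierSq_eq_mask_mul (hb : 2 ≤ b) (ξ : ℝ) :
    fourierSq q b ξ = mask q (ξ / b) * fourierSq q b (ξ / b) := by
  have := cantorMeasure_isProbabilityMeasure q b hb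
  have hc : ∀ i : Fin q, Measurable (contraction b i) := fun i => by
    unfold contraction; fun_prop
  have hexp : ∀ t x : ℝ, ‖Complex.exp (t * x * Complex.I)‖ = 1 := fun t x => by
    rw [← Complex.ofReal_mul]
    exact Complex.norm_exp_ofReal_mul_I _
  have hq : (q : ℝ≥0∞)⁻¹ ≠ ∞ := ENNReal.inv_ne_top.2 (by exact_mod_cast NeZero.ne q)
  have h : charFun (cantorMeasure q b) (2 * Real.pi * ξ) =
      ((q : ℂ)⁻¹ * ∑ i : Fin q, phase ((i : ℕ) * (ξ / b))) *
        charFun (cantorMeasure q b) (2 * Real.pi * (ξ / b)) := by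
    conv_lhs => rw [cantorMeasure_eq_sum_map hb]
    rw [charFun_apply_real, integral_finsetSum_measure, Finset.mul_sum, Finset.sum_mul]
    · refine Finset.sum_congr rfl fun i _ => ?_
      rw [integral_smul_measure, integral_map (hc i).aemeasurable (by fun_prop),
        charFun_apply_real, mul_assoc, ← integral_const_mul, ENNReal.toReal_inv,
        ENNReal.toReal_natCast, Complex.real_smul]
      push_cast
      rw [← integral_const_mul]
      refine integral_congr_ae (ae_of_all _ fun x => ?_)
      unfold phase contraction
      dsimp only
      rw [mul_assoc (_⁻¹), ← Complex.exp_add]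
      push_cast
      ring_nf
    · intro i _
      refine Integrable.smul_measure ?_ hq
      have := Measure.isProbabilityMeasure_map (μ := cantorMeasure q b) (hc i).aemeasurable
      refine Integrable.of_bound (C := 1) (by fun_prop) (ae_of_all _ fun x => ?_)
      exact (hexp _ x).le
  unfold fourierSq mask
  rw [h, norm_mul, mul_pow]

/-- Dividing by b repeatedly reaches ra/b = a/q, a zero of the mask. -/
theorem fourierSq_eq_zero {r : ℕ} (hb : 2 ≤ q * r) (k : ℕ) (a : ℤ) (ha : ¬ (q : ℤ) ∣ a) :
    fourierSq q (q * r) (r * (((q * r : ℕ) : ℝ) ^ k * a)) = 0 := by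
  have hq : (q : ℝ) ≠ 0 := by exact_mod_cast NeZero.ne q
  have hr : (r : ℝ) ≠ 0 := by
    rintro h
    have : r = 0 := by exact_mod_cast h
    simp [this] at hb
  induction k with
  | zero =>
    rw [fourierSq_eq_mask_mul hb, show (r * (((q * r : ℕ) : ℝ) ^ 0 * a) / (q * r : ℕ) : ℝ) = a / q by
      push_cast; field_simp, mask_eq_zero q a ha, zero_mul]
  | succ k ih =>
    rw [fourierSq_eq_mask_mul hb, show (r * (((q * r : ℕ) : ℝ) ^ (k + 1) * a) / (q * r : ℕ) : ℝ) =
      r * (((q * r : ℕ) : ℝ) ^ k * a) by push_cast; field_simp; ring, ih, mul_zero]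

end fourierSq

/-! ### Words and subtrees -/

section words

variable {q : ℕ}

/-- The mapping `σ ↦ g(iσ)` on the subtree at the letter `i`. -/
def subtree (g : List (Fin q) → ℤ) (i : Fin q) : List (Fin q) → ℤ := fun σ => g (i :: σ)

/-- The infinite words in `Γ_q` on which `g` is regular. -/
def regularWords [NeZero q] (g : List (Fin q) → ℤ) : Set (ℕ → Fin q) :=
  {ω | ω ∈ Gam q ∧ IsRegularOn g ω}

theorem prefixWord_consDigit (i : Fin q) (ω : ℕ → Fin q) (k : ℕ) :
    prefixWord (consDigit i ω) (k + 1) = i :: prefixWord ω k := by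
  unfold prefixWord
  rw [List.ofFn_succ]
  rfl

theorem consDigit_mem_Gam [NeZero q] (i : Fin q) (ω : ℕ → Fin q) :
    consDigit i ω ∈ Gam q ↔ ω ∈ Gam q := by
  constructor
  · rintro ⟨σ, hσ⟩
    refine ⟨σ.tail, funext fun k => ?_⟩
    have := congrFun hσ (k + 1)
    cases σ with
    | nil => simpa [zeroExtend, consDigit] using this
    | cons a σ => simpa [zeroExtend, consDigit] using this
  · rintro ⟨σ, rfl⟩
    refine ⟨i :: σ, funext fun k => ?_⟩
    cases k <;> simp [zeroExtend, consDigit]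

theorem isRegularOn_consDigit (g : List (Fin q) → ℤ) (i : Fin q) (ω : ℕ → Fin q) :
    IsRegularOn g (consDigit i ω) ↔ IsRegularOn (fun σ => g (i :: σ)) ω := by
  unfold IsRegularOn
  rw [← map_add_atTop_eq_nat 1, eventually_map]
  simp only [prefixWord_consDigit, map_add_atTop_eq_nat]

theorem consDigit_mem_regularWords [NeZero q] (g : List (Fin q) → ℤ) (i : Fin q) (ω : ℕ → Fin q) :
    consDigit i ω ∈ regularWords g ↔ ω ∈ regularWords (subtree g i) :=
  and_congr (consDigit_mem_Gam i ω) (isRegularOn_consDigit g i ω)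

theorem countable_regularWords [NeZero q] (g : List (Fin q) → ℤ) : (regularWords g).Countable :=
  (Set.countable_range zeroExtend).mono fun _ h => h.1

/-- Infinite words as pairs of a first letter and a remaining word. -/
def consDigitEquiv (q : ℕ) : Fin q × (ℕ → Fin q) ≃ (ℕ → Fin q) where
  toFun p := consDigit p.1 p.2
  invFun ω := (ω 0, fun k => ω (k + 1))
  left_inv _ := rfl
  right_inv ω := by
    ext1 k
    cases k <;> rfl

theorem proj_consDigit (b : ℕ) (g : List (Fin q) → ℤ) (i : Fin q) (ω : ℕ → Fin q)
    (h : IsRegularOn g (consDigit i ω)) :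
    proj b g (consDigit i ω) = g [i] + b * proj b (fun σ => g (i :: σ)) ω := by
  have hs : Summable fun k : ℕ => (g (prefixWord (consDigit i ω) (k + 1)) : ℝ) * (b : ℝ) ^ k := by
    obtain ⟨N, hN⟩ := eventually_atTop.1 h
    refine summable_of_ne_finset_zero (s := Finset.range N) fun k hk => ?_
    rw [hN (k + 1) (by simp at hk; omega)]
    simp
  unfold proj
  rw [hs.tsum_eq_zero_add, ← tsum_mul_left]
  simp only [prefixWord_consDigit]
  congr 1
  · simp [prefixWord]
  · refine tsum_congr fun k => ?_
    ring

theorem exists_int_eq_proj (b : ℕ) (g : List (Fin q) → ℤ) (ω : ℕ → Fin q)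
    (h : IsRegularOn g ω) : ∃ z : ℤ, proj b g ω = z := by
  obtain ⟨N, hN⟩ := eventually_atTop.1 h
  refine ⟨∑ k ∈ Finset.range N, g (prefixWord ω (k + 1)) * (b : ℤ) ^ k, ?_⟩
  unfold proj
  rw [tsum_eq_sum (s := Finset.range N) fun k hk => ?_]
  · push_cast
    rfl
  · rw [hN (k + 1) (by simp at hk; omega)]
    simp

theorem exists_proj_consDigit_sub_eq {r : ℕ} {g : List (Fin q) → ℤ}
    (hg : ∀ (σ : List (Fin q)) (i : Fin q), g (σ ++ [i]) ≡ ((i : ℕ) : ℤ) [ZMOD (q : ℤ)])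
    {i j : Fin q} {ω ω' : ℕ → Fin q} (hω : IsRegularOn g (consDigit i ω))
    (hω' : IsRegularOn g (consDigit j ω')) (hij : i ≠ j) :
    ∃ (k : ℕ) (a : ℤ), ¬ (q : ℤ) ∣ a ∧
      proj (q * r) g (consDigit i ω) - proj (q * r) g (consDigit j ω') =
        ((q * r : ℕ) : ℝ) ^ k * a := by
  rw [proj_consDigit _ _ _ _ hω, proj_consDigit _ _ _ _ hω']
  obtain ⟨z, hz⟩ := exists_int_eq_proj (q * r) _ _ ((isRegularOn_consDigit g i ω).1 hω)
  obtain ⟨w, hw⟩ := exists_int_eq_proj (q * r) _ _ ((isRegularOn_consDigit g j ω').1 hω')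
  refine ⟨0, g [i] - g [j] + q * (r * (z - w)), fun hd => hij ?_, ?_⟩
  · have h1 : g [i] ≡ g [j] [ZMOD (q : ℤ)] :=
      (Int.modEq_iff_dvd.2 ((dvd_add_left (dvd_mul_right _ _)).1 hd)).symm
    have h2 := ((hg [] i).symm.trans h1).trans (hg [] j)
    have h3 : (i : ℕ) % q = (j : ℕ) % q := Int.natCast_modEq_iff.1 h2
    rw [Nat.mod_eq_of_lt i.2, Nat.mod_eq_of_lt j.2] at h3
    exact Fin.ext h3
  · rw [hz, hw]
    push_cast
    ring

/-- Equal initial letters cancel and contribute powers of b; at the first differing letter the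
digits are incongruent modulo q, while later terms are multiples of b, hence of q. -/
theorem exists_proj_sub_eq {r : ℕ} {g : List (Fin q) → ℤ}
    (hg : ∀ (σ : List (Fin q)) (i : Fin q), g (σ ++ [i]) ≡ ((i : ℕ) : ℤ) [ZMOD (q : ℤ)])
    {ω ω' : ℕ → Fin q} (hω : IsRegularOn g ω) (hω' : IsRegularOn g ω') (hne : ω ≠ ω') :
    ∃ (k : ℕ) (a : ℤ), ¬ (q : ℤ) ∣ a ∧
      proj (q * r) g ω - proj (q * r) g ω' = ((q * r : ℕ) : ℝ) ^ k * a := by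
  obtain ⟨n, hn⟩ := Function.ne_iff.1 hne
  clear hne
  induction n generalizing g ω ω' with
  | zero =>
    obtain ⟨⟨i, ω⟩, rfl⟩ := (consDigitEquiv q).surjective ω
    obtain ⟨⟨j, ω'⟩, rfl⟩ := (consDigitEquiv q).surjective ω'
    exact exists_proj_consDigit_sub_eq hg hω hω' hn
  | succ n ih =>
    obtain ⟨⟨i, ω⟩, rfl⟩ := (consDigitEquiv q).surjective ω
    obtain ⟨⟨j, ω'⟩, rfl⟩ := (consDigitEquiv q).surjective ω'
    change IsRegularOn g (consDigit i ω) at hω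
    change IsRegularOn g (consDigit j ω') at hω'
    by_cases hij : i = j
    · subst hij
      obtain ⟨k, a, ha, h⟩ := ih (g := fun σ => g (i :: σ)) (fun σ j => hg (i :: σ) j)
        ((isRegularOn_consDigit g i ω).1 hω) ((isRegularOn_consDigit g i ω').1 hω') hn
      refine ⟨k + 1, a, ha, ?_⟩
      change proj (q * r) g (consDigit i ω) - proj (q * r) g (consDigit i ω') = _
      rw [proj_consDigit _ _ _ _ hω, proj_consDigit _ _ _ _ hω', pow_succ', mul_assoc, ← h]
      ring
    · exact exists_proj_consDigit_sub_eq hg hω hω' hij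

end words

/-! ### The sum over the regular words -/

section wordSum

variable {q r : ℕ} [NeZero q] {g : List (Fin q) → ℤ}

/-- The sum `∑_λ |μ̂(ξ + rλ)|²` over the projections `λ` of the regular words. -/
noncomputable def wordSum (r : ℕ) (g : List (Fin q) → ℤ) (ξ : ℝ) : ℝ≥0∞ :=
  ∑' ω : regularWords g, ENNReal.ofReal (fourierSq q (q * r) (ξ + r * proj (q * r) g ω))

theorem wordSum_eq_sum (hb : 2 ≤ q * r) (g : List (Fin q) → ℤ) (ξ : ℝ) :
    wordSum r g ξ = ∑ i, ENNReal.ofReal (mask q ((ξ + r * g [i]) / (q * r : ℕ))) *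
      wordSum r (subtree g i) ((ξ + r * g [i]) / (q * r : ℕ)) := by
  have hb0 : ((q * r : ℕ) : ℝ) ≠ 0 := by
    have : q * r ≠ 0 := by omega
    exact_mod_cast this
  unfold wordSum
  rw [tsum_subtype (regularWords g)
      (fun ω => ENNReal.ofReal (fourierSq q (q * r) (ξ + r * proj (q * r) g ω))),
    ← (consDigitEquiv q).tsum_eq, ENNReal.tsum_prod', tsum_fintype]
  refine Finset.sum_congr rfl fun i _ => ?_
  rw [tsum_subtype (regularWords (subtree g i)) (fun ω => ENNReal.ofReal (fourierSq q (q * r)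
      ((ξ + r * g [i]) / (q * r : ℕ) + r * proj (q * r) (subtree g i) ω))), ← ENNReal.tsum_mul_left]
  refine tsum_congr fun ω => ?_
  change Set.indicator _ _ (consDigit i ω) = _
  by_cases h : ω ∈ regularWords (subtree g i)
  · have h' := (consDigit_mem_regularWords g i ω).2 h
    rw [Set.indicator_of_mem h, Set.indicator_of_mem h', proj_consDigit _ _ _ _ h'.2,
      ← ENNReal.ofReal_mul (mask_nonneg _ _), fourierSq_eq_mask_mul hb]
    -- The remaining projection is an integer, so by periodicity the mask factor depends only on the
    -- first letter.
    obtain ⟨z, hz⟩ := exists_int_eq_proj (q * r) _ _ h.2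
    have h1 : (ξ + r * (g [i] + (q * r : ℕ) * proj (q * r) (fun σ => g (i :: σ)) ω)) / (q * r : ℕ) =
        (ξ + r * g [i]) / (q * r : ℕ) + r * proj (q * r) (subtree g i) ω := by
      unfold subtree
      field_simp
      ring
    rw [h1]
    congr 2
    rw [hz]
    convert mask_add_int q _ (r * z) using 2
    push_cast
    rfl
  · rw [Set.indicator_of_notMem h,
      Set.indicator_of_notMem fun h' => h ((consDigit_mem_regularWords g i ω).1 h'), mul_zero]

/-- Distinct frequencies differ by some r b^k a with q ∤ a, where μ̂ vanishes. -/
theorem orthonormal_expLp_proj (hb : 2 ≤ q * r) [IsProbabilityMeasure (cantorMeasure q (q * r))]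
    (hg : ∀ (σ : List (Fin q)) (i : Fin q), g (σ ++ [i]) ≡ ((i : ℕ) : ℤ) [ZMOD (q : ℤ)]) :
    Orthonormal ℂ fun ω : regularWords g =>
      expLp (cantorMeasure q (q * r)) (r * proj (q * r) g ω) := by
  refine ⟨fun _ => norm_expLp _ _, fun ω ω' hne => ?_⟩
  obtain ⟨k, a, ha, h⟩ := exists_proj_sub_eq (r := r) hg ω'.2.2 ω.2.2
    fun h => hne (Subtype.ext h.symm)
  have h0 := fourierSq_eq_zero hb k a ha
  rw [← h, fourierSq, pow_eq_zero_iff two_ne_zero, norm_eq_zero, mul_sub (r : ℝ)] at h0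
  simp only [inner_expLp]
  exact h0

theorem injective_proj (hb : 2 ≤ q * r)
    (hg : ∀ (σ : List (Fin q)) (i : Fin q), g (σ ++ [i]) ≡ ((i : ℕ) : ℤ) [ZMOD (q : ℤ)]) :
    Function.Injective fun ω : regularWords g => (r : ℝ) * proj (q * r) g ω := by
  have := cantorMeasure_isProbabilityMeasure q (q * r) hb
  intro ω ω' h
  exact (orthonormal_expLp_proj hb hg).linearIndependent.injective
    (congrArg (expLp (cantorMeasure q (q * r))) h)

theorem norm_sq_inner_expLp_proj [IsProbabilityMeasure (cantorMeasure q (q * r))] (ξ : ℝ)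
    (ω : regularWords g) :
    ‖inner ℂ (expLp (cantorMeasure q (q * r)) (r * proj (q * r) g ω))
      (expLp (cantorMeasure q (q * r)) (-ξ))‖ ^ 2 =
        fourierSq q (q * r) (ξ + r * proj (q * r) g ω) := by
  rw [inner_expLp, ← fourierSq_neg, fourierSq]
  congr 4
  ring

theorem wordSum_le_one (hb : 2 ≤ q * r)
    (hg : ∀ (σ : List (Fin q)) (i : Fin q), g (σ ++ [i]) ≡ ((i : ℕ) : ℤ) [ZMOD (q : ℤ)]) (ξ : ℝ) :
    wordSum r g ξ ≤ 1 := by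
  have := cantorMeasure_isProbabilityMeasure q (q * r) hb
  have ho := orthonormal_expLp_proj hb hg
  unfold wordSum
  simp only [← norm_sq_inner_expLp_proj]
  rw [← ENNReal.ofReal_tsum_of_nonneg (fun _ => by positivity) (ho.inner_products_summable _),
    ENNReal.ofReal_le_one]
  refine (ho.tsum_inner_products_le _).trans ?_
  rw [norm_expLp, one_pow]

theorem wordSum_eq_one_iff (hb : 2 ≤ q * r) [IsProbabilityMeasure (cantorMeasure q (q * r))]
    (hg : ∀ (σ : List (Fin q)) (i : Fin q), g (σ ++ [i]) ≡ ((i : ℕ) : ℤ) [ZMOD (q : ℤ)]) (ξ : ℝ) :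
    wordSum r g ξ = 1 ↔ expLp (cantorMeasure q (q * r)) (-ξ) ∈
      (Submodule.span ℂ (Set.range fun ω : regularWords g =>
        expLp (cantorMeasure q (q * r)) (r * proj (q * r) g ω))).topologicalClosure := by
  rw [← tsum_ofReal_norm_inner_sq_eq_iff (orthonormal_expLp_proj hb hg), norm_expLp, one_pow,
    ENNReal.ofReal_one]
  simp only [norm_sq_inner_expLp_proj]
  rfl

/-- A sum of nonnegative continuous functions is a priori only lower semicontinuous. Closedness
comes instead from the Hilbert space: the set is the preimage of a closed subspace under the
continuous map ξ ↦ e_{-ξ}. -/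
theorem isClosed_wordSum_eq_one (hb : 2 ≤ q * r)
    (hg : ∀ (σ : List (Fin q)) (i : Fin q), g (σ ++ [i]) ≡ ((i : ℕ) : ℤ) [ZMOD (q : ℤ)]) :
    IsClosed {ξ | wordSum r g ξ = 1} := by
  have := cantorMeasure_isProbabilityMeasure q (q * r) hb
  simp only [wordSum_eq_one_iff hb hg]
  exact (Submodule.isClosed_topologicalClosure _).preimage
    ((continuous_expLp _).comp continuous_neg)

/-- The spectrum criterion: `rΛ(g)` is a spectrum if and only if
`∑_{λ ∈ Λ(g)} |μ̂(ξ + rλ)|² = 1` for all `ξ`. -/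
theorem isSpectrum_iff_wordSum_eq_one (hb : 2 ≤ q * r)
    (hg : ∀ (σ : List (Fin q)) (i : Fin q), g (σ ++ [i]) ≡ ((i : ℕ) : ℤ) [ZMOD (q : ℤ)]) :
    IsSpectrum (cantorMeasure q (q * r)) ((fun x : ℝ => (r : ℝ) * x) '' Lam (q * r) g) ↔
      ∀ ξ, wordSum r g ξ = 1 := by
  have := cantorMeasure_isProbabilityMeasure q (q * r) hb
  have := (countable_regularWords g).to_subtype
  have hrange : (fun x : ℝ => (r : ℝ) * x) '' Lam (q * r) g =
      Set.range fun ω : regularWords g => (r : ℝ) * proj (q * r) g ω := by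
    ext x
    constructor
    · rintro ⟨_, ⟨ω, h1, h2, rfl⟩, rfl⟩
      exact ⟨⟨ω, h1, h2⟩, rfl⟩
    · rintro ⟨ω, rfl⟩
      exact ⟨_, ⟨ω, ω.2.1, ω.2.2, rfl⟩, rfl⟩
  rw [hrange, isSpectrum_range_iff _ (injective_proj hb hg) (orthonormal_expLp_proj hb hg)]
  simp only [wordSum_eq_one_iff hb hg]
  exact ⟨fun h ξ => h (-ξ), fun h ξ => by simpa using h (-ξ)⟩

end wordSum

/-! ### Completeness of subtrees -/

/-- Digit mappings: values in `{-1, …, b - 2}`, congruent to the last letter modulo `q`. -/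
structure IsDigitMapping {q : ℕ} (b : ℕ) (g : List (Fin q) → ℤ) : Prop where
  mem_digits : ∀ σ, g σ ∈ Set.Icc (-1 : ℤ) ((b : ℤ) - 2)
  modEq_last : ∀ (σ : List (Fin q)) (i : Fin q), g (σ ++ [i]) ≡ ((i : ℕ) : ℤ) [ZMOD (q : ℤ)]

theorem IsMaximalMapping.isDigitMapping {q b : ℕ} [NeZero q] {τ : List (Fin q) → ℤ}
    (h : IsMaximalMapping b τ) : IsDigitMapping b τ := ⟨h.mem_digits, h.modEq_last⟩

theorem IsDigitMapping.subtree {q b : ℕ} {g : List (Fin q) → ℤ} (hg : IsDigitMapping b g)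
    (i : Fin q) :
    IsDigitMapping b (subtree g i) :=
  ⟨fun σ => hg.mem_digits (i :: σ), fun σ j => hg.modEq_last (i :: σ) j⟩

section defect

variable {q r : ℕ} [NeZero q] {g : List (Fin q) → ℤ}

/-- The identity `∑_λ |μ̂(ξ + rλ)|² = 1` for the projections `λ` of the regular words of `g`. -/
def IsComplete (r : ℕ) (g : List (Fin q) → ℤ) : Prop := ∀ ξ, wordSum r g ξ = 1

/-- The defect in Bessel's inequality. -/
noncomputable def defect (r : ℕ) (g : List (Fin q) → ℤ) (ξ : ℝ) : ℝ := 1 - (wordSum r g ξ).toReal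

theorem wordSum_ne_top (hb : 2 ≤ q * r) (hg : IsDigitMapping (q * r) g) (ξ : ℝ) :
    wordSum r g ξ ≠ ∞ :=
  ne_top_of_le_ne_top ENNReal.one_ne_top (wordSum_le_one hb hg.modEq_last ξ)

theorem defect_nonneg (hb : 2 ≤ q * r) (hg : IsDigitMapping (q * r) g) (ξ : ℝ) :
    0 ≤ defect r g ξ :=
  sub_nonneg.2 (ENNReal.toReal_le_of_le_ofReal zero_le_one
    (by simpa using wordSum_le_one hb hg.modEq_last ξ))

theorem defect_le_one (ξ : ℝ) : defect r g ξ ≤ 1 := by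
  unfold defect
  linarith [ENNReal.toReal_nonneg (a := wordSum r g ξ)]

theorem defect_eq_zero_iff (ξ : ℝ) : defect r g ξ = 0 ↔ wordSum r g ξ = 1 := by
  unfold defect
  rw [sub_eq_zero, eq_comm, ENNReal.toReal_eq_one_iff]

/-- The digits g(i) form a complete residue system modulo q, so the mask weights add up to 1 and the
recursion for the sum passes to its defect. -/
theorem defect_eq_sum (hb : 2 ≤ q * r) (hg : IsDigitMapping (q * r) g) (ξ : ℝ) :
    defect r g ξ = ∑ i, mask q ((ξ + r * g [i]) / (q * r : ℕ)) *
      defect r (subtree g i) ((ξ + r * g [i]) / (q * r : ℕ)) := by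
  have hq : (q : ℝ) ≠ 0 := by exact_mod_cast NeZero.ne q
  have hr : (r : ℝ) ≠ 0 := by
    have : r ≠ 0 := by
      rintro rfl
      simp at hb
    exact_mod_cast this
  have h1 : ∑ i, mask q ((ξ + r * g [i]) / (q * r : ℕ)) = 1 := by
    rw [← sum_mask_eq_one q (ξ / (q * r : ℕ)) (fun i => g [i]) fun i => hg.modEq_last [] i]
    refine Finset.sum_congr rfl fun i _ => ?_
    congr 1
    push_cast
    field_simp
  unfold defect
  simp only [mul_sub, mul_one, Finset.sum_sub_distrib, h1]
  rw [wordSum_eq_sum hb, ENNReal.toReal_sum fun i _ =>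
    ENNReal.mul_ne_top ENNReal.ofReal_ne_top (wordSum_ne_top hb (hg.subtree i) _)]
  simp only [ENNReal.toReal_mul, ENNReal.toReal_ofReal (mask_nonneg _ _)]

theorem isComplete_iff_forall_subtree (hb : 2 ≤ q * r) (hg : IsDigitMapping (q * r) g) :
    IsComplete r g ↔ ∀ i, IsComplete r (subtree g i) := by
  have hb0 : ((q * r : ℕ) : ℝ) ≠ 0 := by
    have : q * r ≠ 0 := by omega
    exact_mod_cast this
  constructor
  · intro h i η
    have hd : Dense {η | wordSum r (subtree g i) η = 1} := by
      refine (dense_mask_ne_zero q).mono fun η hη => ?_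
      -- This frequency is chosen so that the i-th rescaled argument is exactly η.
      have h0 := (defect_eq_zero_iff _).2 (h ((q * r : ℕ) * η - r * g [i]))
      rw [defect_eq_sum hb hg, Finset.sum_eq_zero_iff_of_nonneg fun j _ =>
        mul_nonneg (mask_nonneg _ _) (defect_nonneg hb (hg.subtree j) _)] at h0
      have h1 := h0 i (Finset.mem_univ i)
      rw [sub_add_cancel, mul_div_cancel_left₀ _ hb0, mul_eq_zero, or_iff_right hη] at h1
      exact (defect_eq_zero_iff _).1 h1
    have h2 := (isClosed_wordSum_eq_one hb (hg.subtree i).modEq_last).closure_eq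
    rw [hd.closure_eq] at h2
    exact (Set.ext_iff.1 h2 η).1 trivial
  · intro h ξ
    rw [← defect_eq_zero_iff, defect_eq_sum hb hg]
    exact Finset.sum_eq_zero fun i _ => by rw [(defect_eq_zero_iff _).2 (h i _), mul_zero]

/-! ### The branch of zeros -/

/-- The mapping `σ ↦ g(0ⁿσ)`. -/
def zeroTail (g : List (Fin q) → ℤ) (n : ℕ) : List (Fin q) → ℤ :=
  fun σ => g (List.replicate n 0 ++ σ)

theorem IsDigitMapping.zeroTail {b : ℕ} (hg : IsDigitMapping b g) (n : ℕ) :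
    IsDigitMapping b (zeroTail g n) :=
  ⟨fun σ => hg.mem_digits _, fun σ j => by
    unfold CantorSpectra.zeroTail
    rw [← List.append_assoc]
    exact hg.modEq_last _ j⟩

theorem subtree_zeroTail_zero (g : List (Fin q) → ℤ) (n : ℕ) :
    subtree (zeroTail g n) 0 = zeroTail g (n + 1) := by
  ext σ
  simp [subtree, zeroTail, List.replicate_succ']

theorem zeroTail_zero_singleton (g : List (Fin q) → ℤ) (n : ℕ) :
    zeroTail g n [0] = g (List.replicate (n + 1) 0) := by
  simp [zeroTail, List.replicate_succ']

/-- The frequencies met along the branch of zeros, starting from `ξ`. -/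
noncomputable def zeroOrbit (r : ℕ) (g : List (Fin q) → ℤ) (ξ : ℝ) : ℕ → ℝ
  | 0 => ξ
  | n + 1 => (zeroOrbit r g ξ n + r * g (List.replicate (n + 1) 0)) / (q * r : ℕ)

theorem defect_zeroTail (hb : 2 ≤ q * r) (hg : IsDigitMapping (q * r) g)
    (h : ∀ n, ∀ j ≠ 0, IsComplete r (subtree (zeroTail g n) j)) (ξ : ℝ) (n : ℕ) :
    defect r (zeroTail g n) (zeroOrbit r g ξ n) =
      mask q (zeroOrbit r g ξ (n + 1)) *
        defect r (zeroTail g (n + 1)) (zeroOrbit r g ξ (n + 1)) := by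
  rw [defect_eq_sum hb (hg.zeroTail n), Finset.sum_eq_single 0 (fun j _ hj => by
      rw [(defect_eq_zero_iff _).2 (h n j hj _), mul_zero])
      (fun h0 => absurd (Finset.mem_univ _) h0),
    subtree_zeroTail_zero, zeroTail_zero_singleton]
  rfl

theorem defect_eq_prod_mul (hb : 2 ≤ q * r) (hg : IsDigitMapping (q * r) g)
    (h : ∀ n, ∀ j ≠ 0, IsComplete r (subtree (zeroTail g n) j)) (ξ : ℝ) (n : ℕ) :
    defect r g ξ = (∏ k ∈ Finset.range n, mask q (zeroOrbit r g ξ (k + 1))) *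
      defect r (zeroTail g n) (zeroOrbit r g ξ n) := by
  induction n with
  | zero =>
    rw [Finset.prod_range_zero, one_mul]
    rfl
  | succ n ih => rw [ih, defect_zeroTail hb hg h, Finset.prod_range_succ, mul_assoc]

theorem prefixWord_zero (k : ℕ) : prefixWord (fun _ => (0 : Fin q)) k = List.replicate k 0 :=
  List.ofFn_const k 0

/-- If `g` vanishes along the branch of zeros, then the word `0^∞` contributes to the sum. -/
theorem defect_le_one_sub_fourierSq (hb : 2 ≤ q * r) (hg : IsDigitMapping (q * r) g)
    (h0 : ∀ n, g (List.replicate (n + 1) 0) = 0) (ξ : ℝ) :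
    defect r g ξ ≤ 1 - fourierSq q (q * r) ξ := by
  have hmem : (fun _ => 0 : ℕ → Fin q) ∈ regularWords g := by
    refine ⟨⟨[], funext fun k => by simp [zeroExtend]⟩, ?_⟩
    refine eventually_atTop.2 ⟨1, fun k hk => ?_⟩
    obtain ⟨n, rfl⟩ := Nat.exists_eq_add_of_le' hk
    rw [prefixWord_zero, h0]
  have hproj : proj (q * r) g (fun _ => 0 : ℕ → Fin q) = 0 := by
    unfold proj
    simp [prefixWord_zero, h0]
  have h1 : ENNReal.ofReal (fourierSq q (q * r) ξ) ≤ wordSum r g ξ := by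
    have := ENNReal.le_tsum (f := fun ω : regularWords g =>
      ENNReal.ofReal (fourierSq q (q * r) (ξ + r * proj (q * r) g ω))) ⟨_, hmem⟩
    simp only [hproj, mul_zero, add_zero] at this
    exact this
  have h2 := (ENNReal.ofReal_le_iff_le_toReal (wordSum_ne_top hb hg ξ)).1 h1
  unfold defect
  linarith

/-- Past level N the orbit is merely divided by b, so it tends to 0. There the tail defect is at
most 1 - |μ̂(x_n)|², which tends to 0 because μ̂(0) = 1. -/
theorem defect_eq_zero_of_regular (hb : 2 ≤ q * r) (hg : IsDigitMapping (q * r) g)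
    (h : ∀ n, ∀ j ≠ 0, IsComplete r (subtree (zeroTail g n) j)) (N : ℕ)
    (hN : ∀ n ≥ N, g (List.replicate n 0) = 0) (ξ : ℝ) : defect r g ξ = 0 := by
  have hb1 : (1 : ℝ) < (q * r : ℕ) := by exact_mod_cast hb
  have hx : ∀ n, zeroOrbit r g ξ (n + N) = zeroOrbit r g ξ N * (((q * r : ℕ) : ℝ)⁻¹) ^ n := by
    intro n
    induction n with
    | zero => simp
    | succ n ih =>
      rw [show n + 1 + N = n + N + 1 by ring, zeroOrbit, hN _ (by omega), ih, pow_succ,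
        div_eq_mul_inv]
      simp
      ring
  have hlim : Tendsto (fun n => zeroOrbit r g ξ (n + N)) atTop (nhds 0) := by
    simp only [hx]
    simpa using (tendsto_pow_atTop_nhds_zero_of_lt_one (by positivity)
      (inv_lt_one_of_one_lt₀ hb1)).const_mul (zeroOrbit r g ξ N)
  have hlim' : Tendsto (fun n => 1 - fourierSq q (q * r) (zeroOrbit r g ξ (n + N))) atTop
      (nhds 0) := by
    have := ((continuous_fourierSq (q := q) hb).tendsto 0).comp hlim
    rw [fourierSq_zero hb] at this
    simpa [Function.comp_def] using this.const_sub 1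
  refine le_antisymm (ge_of_tendsto' hlim' fun n => ?_) (defect_nonneg hb hg ξ)
  rw [defect_eq_prod_mul hb hg h ξ (n + N)]
  refine (mul_le_of_le_one_left (defect_nonneg hb (hg.zeroTail _) _)
    (Finset.prod_le_one (fun _ _ => mask_nonneg _ _) fun _ _ => mask_le_one _ _)).trans ?_
  refine defect_le_one_sub_fourierSq hb (hg.zeroTail _) (fun k => ?_) _
  unfold zeroTail
  rw [List.replicate_append_replicate]
  exact hN _ (by omega)

/-- Digits on the zero branch are multiples of q in [-1, qr - 2]; since q ≥ 2, the value -1 is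
excluded. Each step of the orbit therefore adds an integer between 0 and r - 1. -/
theorem exists_mul_eq_replicate_zero (hq : 2 ≤ q) (hg : IsDigitMapping (q * r) g) (n : ℕ) :
    ∃ m : ℕ, m + 1 ≤ r ∧ g (List.replicate (n + 1) 0) = q * m := by
  have h1 := hg.mem_digits (List.replicate (n + 1) 0)
  have h2 := hg.modEq_last (List.replicate n 0) 0
  rw [← List.replicate_succ'] at h2
  obtain ⟨m, hm⟩ := (Int.modEq_zero_iff_dvd).1 (by simpa using h2)
  rw [hm] at h1 ⊢
  obtain ⟨h3, h4⟩ := h1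
  have hq' : (2 : ℤ) ≤ q := by exact_mod_cast hq
  have hm0 : 0 ≤ m := by
    by_contra hneg
    nlinarith
  lift m to ℕ using hm0
  refine ⟨m, ?_, rfl⟩
  push_cast at h4
  have : (m : ℤ) < r := by
    by_contra hneg
    nlinarith
  exact_mod_cast this

theorem zeroOrbit_succ_of_eq_mul (hb : 2 ≤ q * r) (ξ : ℝ) {n m : ℕ}
    (hm : g (List.replicate (n + 1) 0) = q * m) :
    zeroOrbit r g ξ (n + 1) = zeroOrbit r g ξ n / (q * r : ℕ) + m := by
  have hb0 : ((q * r : ℕ) : ℝ) ≠ 0 := by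
    have : q * r ≠ 0 := by omega
    exact_mod_cast this
  rw [zeroOrbit, hm, add_div]
  congr 1
  rw [div_eq_iff hb0]
  push_cast
  ring

theorem zeroOrbit_mem_Icc (hq : 2 ≤ q) (hb : 2 ≤ q * r) (hg : IsDigitMapping (q * r) g) (ξ : ℝ)
    (n : ℕ) : zeroOrbit r g ξ n ∈ Set.Icc (-(|ξ| / ((q * r : ℕ) : ℝ) ^ n))
      (|ξ| / ((q * r : ℕ) : ℝ) ^ n + r) := by
  have hb1 : (1 : ℝ) < (q * r : ℕ) := by exact_mod_cast hb
  induction n with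
  | zero =>
    have hr : (0 : ℝ) ≤ r := by positivity
    simp only [zeroOrbit, pow_zero, div_one]
    exact ⟨neg_abs_le ξ, by linarith [le_abs_self ξ]⟩
  | succ n ih =>
    obtain ⟨m, hmr, hm⟩ := exists_mul_eq_replicate_zero hq hg n
    rw [zeroOrbit_succ_of_eq_mul hb ξ hm, pow_succ, ← div_div]
    have hm' : (m : ℝ) + 1 ≤ r := by exact_mod_cast hmr
    have hm0 : (0 : ℝ) ≤ m := by positivity
    have hrb : (r : ℝ) / (q * r : ℕ) ≤ 1 := by
      rw [div_le_one (by positivity)]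
      exact_mod_cast Nat.le_mul_of_pos_left r (by omega)
    have h1 := div_le_div_of_nonneg_right ih.1 (by positivity : (0 : ℝ) ≤ (q * r : ℕ))
    have h2 := div_le_div_of_nonneg_right ih.2 (by positivity : (0 : ℝ) ≤ (q * r : ℕ))
    rw [neg_div] at h1
    rw [add_div] at h2
    exact ⟨by linarith, by linarith⟩

/-- A nonzero digit pushes the orbit to at least about 1 while it stays below about r; after the
next division by b it is away from ℤ, whatever the next digit, as that shifts by an integer. So the
mask one level later is uniformly below 1. -/
theorem defect_eq_zero_of_not_regular (hq : 2 ≤ q) (hb : 2 ≤ q * r)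
    (hg : IsDigitMapping (q * r) g)
    (h : ∀ n, ∀ j ≠ 0, IsComplete r (subtree (zeroTail g n) j))
    (hN : ∃ᶠ n in atTop, g (List.replicate (n + 1) 0) ≠ 0) (ξ : ℝ) : defect r g ξ = 0 := by
  have hb1 : (1 : ℝ) < (q * r : ℕ) := by exact_mod_cast hb
  have hb2 : (2 : ℝ) ≤ (q * r : ℕ) := by exact_mod_cast hb
  have hlow : (0 : ℝ) < 1 / (2 * (q * r : ℕ)) := by positivity
  -- Once |ξ|/b^(n+1) ≤ 1/2, a nonzero digit puts x_{n+1} in [1/2, r + 1/2]. Dividing by b, with b ≥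
  -- 2 and b ≥ 2r, gives these endpoints.
  have hne : (Set.Icc (1 / (2 * (q * r : ℕ)) : ℝ) (3 / 4)).Nonempty := by
    refine Set.nonempty_Icc.2 ?_
    rw [div_le_iff₀ (by positivity)]
    linarith
  obtain ⟨x₀, hx₀, hmax⟩ := isCompact_Icc.exists_isMaxOn hne (continuous_mask q).continuousOn
  have hc := mask_lt_one q hq x₀ (hlow.trans_le hx₀.1) (by linarith [hx₀.2])
  set P : ℕ → ℝ := fun n => ∏ k ∈ Finset.range n, mask q (zeroOrbit r g ξ (k + 1))
  have hP0 : ∀ n, 0 ≤ P n := fun n => Finset.prod_nonneg fun _ _ => mask_nonneg _ _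
  have hPs : ∀ n, P (n + 1) = P n * mask q (zeroOrbit r g ξ (n + 1)) := fun n =>
    Finset.prod_range_succ _ _
  have hanti : Antitone P := antitone_nat_of_succ_le fun n => by
    rw [hPs]
    exact mul_le_of_le_one_right (hP0 n) (mask_le_one _ _)
  have hlim := tendsto_atTop_ciInf hanti ⟨0, by rintro _ ⟨n, rfl⟩; exact hP0 n⟩
  set L := ⨅ n, P n
  have hsmall : ∀ᶠ n : ℕ in atTop, |ξ| / ((q * r : ℕ) : ℝ) ^ (n + 1) ≤ 1 / 2 := by
    have h1 : Tendsto (fun n : ℕ => |ξ| / ((q * r : ℕ) : ℝ) ^ (n + 1)) atTop (nhds 0) :=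
      (tendsto_const_nhds.div_atTop (tendsto_pow_atTop_atTop_of_one_lt hb1)).comp
        (tendsto_add_atTop_nat 1)
    exact h1.eventually_le_const (by norm_num)
  have hfreq : ∃ᶠ n in atTop, P (n + 2) - P (n + 1) * mask q x₀ ≤ 0 := by
    refine (hN.and_eventually hsmall).mono fun n hn => ?_
    obtain ⟨hn0, hn1⟩ := hn
    obtain ⟨m, hmr, hm⟩ := exists_mul_eq_replicate_zero hq hg n
    obtain ⟨m', -, hm'⟩ := exists_mul_eq_replicate_zero hq hg (n + 1)
    have hm1 : (1 : ℝ) ≤ m := by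
      have : m ≠ 0 := by
        rintro rfl
        simp [hm] at hn0
      exact_mod_cast Nat.one_le_iff_ne_zero.2 this
    have hup := (zeroOrbit_mem_Icc hq hb hg ξ (n + 1)).2
    have hlo : 1 / 2 ≤ zeroOrbit r g ξ (n + 1) := by
      have h1 := div_le_div_of_nonneg_right (zeroOrbit_mem_Icc hq hb hg ξ n).1
        (by positivity : (0 : ℝ) ≤ (q * r : ℕ))
      rw [neg_div, div_div, ← pow_succ] at h1
      rw [zeroOrbit_succ_of_eq_mul hb ξ hm]
      linarith
    have hmem : zeroOrbit r g ξ (n + 1) / (q * r : ℕ) ∈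
        Set.Icc (1 / (2 * (q * r : ℕ)) : ℝ) (3 / 4) := by
      have hr2 : 2 * (r : ℝ) ≤ (q * r : ℕ) := by exact_mod_cast Nat.mul_le_mul_right r hq
      constructor
      · rw [← div_div]
        gcongr
      · rw [div_le_iff₀ (by positivity)]
        linarith
    have hmask := hmax hmem
    rw [hPs (n + 1), zeroOrbit_succ_of_eq_mul hb ξ hm']
    have h2 : mask q (zeroOrbit r g ξ (n + 1) / (q * r : ℕ) + m') =
        mask q (zeroOrbit r g ξ (n + 1) / (q * r : ℕ)) := by
      exact_mod_cast mask_add_int q _ (m' : ℤ)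
    rw [h2, sub_nonpos]
    exact mul_le_mul_of_nonneg_left hmask (hP0 _)
  -- Passing to the limit along the infinitely many good levels gives L ≤ cL with c < 1, hence L ≤
  -- 0.
  have hL : L - L * mask q x₀ ≤ 0 := by
    refine le_of_tendsto_of_frequently ?_ hfreq
    exact (hlim.comp (tendsto_add_atTop_nat 2)).sub
      ((hlim.comp (tendsto_add_atTop_nat 1)).mul_const _)
  have hL0 : L ≤ 0 := by
    by_contra hneg
    nlinarith
  refine le_antisymm (le_trans (ge_of_tendsto' hlim fun n => ?_) hL0) (defect_nonneg hb hg ξ)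
  rw [defect_eq_prod_mul hb hg h ξ n]
  exact mul_le_of_le_one_right (hP0 n) (defect_le_one _)

theorem isComplete_zeroTail (hb : 2 ≤ q * r) (hg : IsDigitMapping (q * r) g)
    (h : IsComplete r g) (n : ℕ) : IsComplete r (zeroTail g n) := by
  induction n with
  | zero => exact h
  | succ n ih =>
    rw [← subtree_zeroTail_zero]
    exact (isComplete_iff_forall_subtree hb (hg.zeroTail n)).1 ih 0

/-- Completeness does not depend on the values along the branch of zeros. -/
theorem isComplete_iff_forall_subtree_zeroTail (hq : 2 ≤ q) (hb : 2 ≤ q * r)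
    (hg : IsDigitMapping (q * r) g) :
    IsComplete r g ↔ ∀ n, ∀ j ≠ 0, IsComplete r (subtree (zeroTail g n) j) := by
  constructor
  · intro h n j _
    exact (isComplete_iff_forall_subtree hb (hg.zeroTail n)).1 (isComplete_zeroTail hb hg h n) j
  · intro h ξ
    rw [← defect_eq_zero_iff]
    by_cases hN : ∃ᶠ n in atTop, g (List.replicate (n + 1) 0) ≠ 0
    · exact defect_eq_zero_of_not_regular hq hb hg h hN ξ
    · simp only [not_frequently, not_not] at hN
      obtain ⟨N, hN⟩ := eventually_atTop.1 hN
      refine defect_eq_zero_of_regular hb hg h (N + 1) (fun n hn => ?_) ξ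
      obtain ⟨k, rfl⟩ := Nat.exists_eq_add_of_le' (show 1 ≤ n by omega)
      exact hN k (by omega)

end defect

/-! ### Zeroing a mapping along `I0^∞` -/

section zeroAlong

variable {q r : ℕ} [NeZero q]

theorem zeroAlong_eq_zero_or (τ : List (Fin q) → ℤ) (I σ : List (Fin q)) :
    zeroAlong τ I σ = 0 ∨ zeroAlong τ I σ = τ σ := by
  unfold zeroAlong
  split_ifs <;> simp

/-- The value 0 is admissible because every altered word ends in the letter 0. -/
theorem IsDigitMapping.zeroAlong (hb : 2 ≤ q * r) {g : List (Fin q) → ℤ}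
    (hg : IsDigitMapping (q * r) g) (I : List (Fin q)) :
    IsDigitMapping (q * r) (zeroAlong g I) := by
  refine ⟨fun σ => ?_, fun σ i => ?_⟩
  · rcases zeroAlong_eq_zero_or g I σ with h | h
    · rw [h]
      have : (2 : ℤ) ≤ (q * r : ℕ) := by exact_mod_cast hb
      exact ⟨by norm_num, by linarith⟩
    · rw [h]
      exact hg.mem_digits σ
  · unfold CantorSpectra.zeroAlong
    split_ifs with h
    · obtain ⟨l, hl, h⟩ := h
      obtain ⟨m, rfl⟩ := Nat.exists_eq_add_of_le' hl
      rw [List.replicate_succ', ← List.append_assoc] at h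
      have hi := (List.append_inj' h rfl).2
      simp only [List.cons.injEq, and_true] at hi
      subst hi
      simp
    · exact hg.modEq_last σ i

theorem IsMaximalMapping.zeroAlong (hb : 2 ≤ q * r) {τ : List (Fin q) → ℤ}
    (hτ : IsMaximalMapping (q * r) τ) (I : List (Fin q)) :
    IsMaximalMapping (q * r) (zeroAlong τ I) where
  mem_digits := (hτ.isDigitMapping.zeroAlong hb I).mem_digits
  modEq_last := (hτ.isDigitMapping.zeroAlong hb I).modEq_last
  zero_word n := by
    rcases zeroAlong_eq_zero_or τ I (List.replicate n 0) with h | h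
    · exact h
    · rw [h, hτ.zero_word]
  exists_regular σ := by
    obtain ⟨σ', h⟩ := hτ.exists_regular σ
    refine ⟨σ', Eventually.mono h fun k hk => ?_⟩
    rcases zeroAlong_eq_zero_or τ I (prefixWord (zeroExtend (σ ++ σ')) k) with h | h
    · exact h
    · rw [h, hk]

theorem subtree_zeroTail_zeroAlong_nil (g : List (Fin q) → ℤ) (n : ℕ) {j : Fin q} (hj : j ≠ 0) :
    subtree (zeroTail (zeroAlong g []) n) j = subtree (zeroTail g n) j := by
  ext σ
  unfold subtree zeroTail zeroAlong
  rw [if_neg]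
  -- A word 0ⁿjσ contains the nonzero letter j, so it is never one of the altered words 0^ℓ.
  rintro ⟨l, -, h⟩
  refine hj (List.eq_of_mem_replicate (n := l) ?_)
  rw [List.nil_append] at h
  rw [← h]
  simp

theorem subtree_zeroAlong_cons_self (g : List (Fin q) → ℤ) (i : Fin q) (I : List (Fin q)) :
    subtree (zeroAlong g (i :: I)) i = zeroAlong (subtree g i) I := by
  ext σ
  unfold subtree zeroAlong
  classical exact if_congr (by simp) rfl rfl

theorem subtree_zeroAlong_cons_of_ne (g : List (Fin q) → ℤ) {i j : Fin q} (I : List (Fin q))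
    (h : j ≠ i) : subtree (zeroAlong g (i :: I)) j = subtree g j := by
  ext σ
  simp [subtree, zeroAlong, h]

/-- Each letter of I peels off one level, where only one subtree is altered. At the end of I, the
subtrees leaving the zero branch are unchanged, and they alone decide completeness. -/
theorem isComplete_zeroAlong_iff (hq : 2 ≤ q) (hb : 2 ≤ q * r) {g : List (Fin q) → ℤ}
    (hg : IsDigitMapping (q * r) g) (I : List (Fin q)) :
    IsComplete r (zeroAlong g I) ↔ IsComplete r g := by
  induction I generalizing g with
  | nil =>
    rw [isComplete_iff_forall_subtree_zeroTail hq hb hg,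
      isComplete_iff_forall_subtree_zeroTail hq hb (hg.zeroAlong hb [])]
    refine forall_congr' fun n => forall_congr' fun j => forall_congr' fun hj => ?_
    rw [subtree_zeroTail_zeroAlong_nil g n hj]
  | cons i I ih =>
    rw [isComplete_iff_forall_subtree hb hg,
      isComplete_iff_forall_subtree hb (hg.zeroAlong hb (i :: I))]
    refine forall_congr' fun j => ?_
    by_cases hj : j = i
    · subst hj
      rw [subtree_zeroAlong_cons_self, ih (hg.subtree j)]
    · rw [subtree_zeroAlong_cons_of_ne g I hj]

end zeroAlong

end CantorSpectra

theorem theorem5 (q r : ℕ) [NeZero q] (hq : q < q * r) (hb : 2 < q * r)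
    (τ : List (Fin q) → ℤ) (hτ : CantorSpectra.IsMaximalMapping (q * r) τ)
    (I : List (Fin q)) (hI : I ≠ []) (hlast : I.getLast hI ≠ 0) :
    CantorSpectra.IsMaximalMapping (q * r) (CantorSpectra.zeroAlong τ I) ∧
    (CantorSpectra.IsSpectralMapping r τ ↔
      CantorSpectra.IsSpectralMapping r (CantorSpectra.zeroAlong τ I)) := by
  -- A nonzero letter exists, so the alphabet has at least two letters.
  have hq2 : 2 ≤ q := by
    by_contra h
    obtain rfl : q = 1 := by
      have := NeZero.ne q
      omega
    exact hlast (Subsingleton.elim _ _)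
  have hτ' := hτ.zeroAlong hb.le I
  refine ⟨hτ', and_congr (iff_of_true hτ hτ') ?_⟩
  rw [CantorSpectra.isSpectrum_iff_wordSum_eq_one hb.le hτ.modEq_last,
    CantorSpectra.isSpectrum_iff_wordSum_eq_one hb.le hτ'.modEq_last]
  exact (CantorSpectra.isComplete_zeroAlong_iff hq2 hb.le hτ.isDigitMapping I).symm
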